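/- **Theorem (Back-door criterion, interventions on many nodes).** Let $G$ be a directed acyclic graph on a finite set of nodes. A *non-parametric structural equation model with independent errors* (NPSEM-IE) on $G$ consists of jointly independent random disturbances $U_i$, one for each node $i$, on a probability space, and measurable functions $f_i$ of the values at the parents of $i$ in $G$ and of a disturbance value. It defines the factual variables by the recurrence $V_i=f_i(PA_i,U_i)$, where $PA_i=(V_j: j \text{ a parent of } i)$. State spaces are measurable spaces whose singletons are measurable. Let $A_{set}$ be a set of nodes with factual variables $A=(A_1,\dots,A_k)$, and let $a=(a_1,\dots,a_k)$ be a vector of possible values of them. The counterfactual variables $V_{a,i}$ are those defined by the modified model in which $f_i$ is replaced by the constant $a_i$ for each node $i$ in $A_{set}$, while all other functions and all disturbances are kept. Fix a response node with factual variable $Y$ and counterfactual variable $Y_a$. Let $\mathbf L$ be a set of nodes with $\mathbf L\cap A_{set}=\emptyset$, whose vector of factual variables $L$ takes values in a countable set. Assume: 1. no element of $\mathbf L$ is a descendant in $G$ of a node of $A_{set}$; 2. $\mathbf L$ blocks every back-door path in $G$ from $A_{set}$ to the response node. A back-door path is a path without repeated nodes, along edges of $G$ taken in either direction, from a node of $A_{set}$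 to the response node, whose first edge is an arrow pointing into that node of $A_{set}$. It is blocked by $\mathbf L$ if some inner node of the path is either a non-collider on the path that belongs to $\mathbf L$, or a collider on the path (both adjacent edges of the path point into it) such that neither it nor any of its descendants in $G$ belongs to $\mathbf L$; 3. (positivity) $P(A=a\mid L=\ell)>0$ for every $\ell$ with $P(L=\ell)>0$. Then for every $y$, $$P(Y_a=y)=\sum_{\ell}P(Y=y\mid A=a,\,L=\ell)\,P(L=\ell),$$ where terms with $P(L=\ell)=0$ are read as $0$. -/

import Mathlib

open MeasureTheory ProbabilityTheory

namespace Causal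

/-- A directed acyclic graph; `G.Adj i j` means that an arrow points from `i` to `j`. -/
structure DAG (V : Type*) extends Digraph V where
  acyclic : ∀ v, ¬ Relation.TransGen Adj v v

namespace DAG

variable {V : Type*} (G : DAG V)

/-- The parents of a node. -/
def parents (i : V) : Set V := {j | G.Adj j i}

/-- `G.IsDescendant i d`: there is a directed path with at least one arrow from `i` to `d`. -/
def IsDescendant (i d : V) : Prop := Relation.TransGen G.Adj i d

/-- The undirected graph obtained from `G` by forgetting the directions of the arrows. -/
def skeleton : SimpleGraph V where
  Adj i j := G.Adj i j ∨ G.Adj j i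
  symm := ⟨fun _ _ h => h.symm⟩
  loopless := ⟨fun i h => G.acyclic i (Relation.TransGen.single (h.elim id id))⟩

/-- The `k`-th inner node (counted from `0`) of the walk, that is, the vertex number `k + 1`,
is a collider: both neighbouring edges on the walk point into it. -/
def IsCollider {u v : V} (p : G.skeleton.Walk u v) (k : ℕ) : Prop :=
  G.Adj (p.getVert k) (p.getVert (k + 1)) ∧ G.Adj (p.getVert (k + 2)) (p.getVert (k + 1))

/-- `L` blocks the path `p`: some inner node of `p` is either a non-collider (middle of a chain
or of a fork) that lies in `L`, or a collider such that neither it nor any of its descendants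
lies in `L`. -/
def Blocks (L : Set V) {u v : V} (p : G.skeleton.Walk u v) : Prop :=
  ∃ k, k + 2 ≤ p.length ∧
    ((¬ G.IsCollider p k ∧ p.getVert (k + 1) ∈ L) ∨
      (G.IsCollider p k ∧ p.getVert (k + 1) ∉ L ∧
        ∀ d, G.IsDescendant (p.getVert (k + 1)) d → d ∉ L))

/-- A back-door path from `u` to `v`: a path (no repeated nodes) between `u` and `v` whose first
edge is an arrow pointing into `u`. -/
def IsBackDoorPath {u v : V} (p : G.skeleton.Walk u v) : Prop :=
  p.IsPath ∧ 1 ≤ p.length ∧ G.Adj (p.getVert 1) u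

/-- `L` blocks all back-door paths from (nodes of) the set `A` to the node `y`. -/
def BlocksBackDoor (L A : Set V) (y : V) : Prop :=
  ∀ u ∈ A, ∀ p : G.skeleton.Walk u y, G.IsBackDoorPath p → G.Blocks L p

/-- On finitely many nodes, recursion along the arrows of `G` is well founded. -/
theorem wf [Finite V] : WellFounded G.Adj := by
  have : IsTrans V (Relation.TransGen G.Adj) := ⟨fun _ _ _ => Relation.TransGen.trans⟩
  have : Std.Irrefl (Relation.TransGen G.Adj) := ⟨G.acyclic⟩
  exact Subrelation.wf (fun h => Relation.TransGen.single h)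
    (Finite.wellFounded_of_trans_of_irrefl (Relation.TransGen G.Adj))

end DAG

/-- A non-parametric structural equation model with independent errors `M = (F, U)` on the
DAG `G`: a measurable function `f i` of the values of the parents of `i` and of the `i`-th
disturbance for every node `i`, and jointly independent disturbances `U i`. The variables
of node `i` take values in `S i`, its disturbance takes values in `E i`. -/
structure NPSEMIE {V : Type*} (G : DAG V) (S E : V → Type*)
    [∀ i, MeasurableSpace (S i)] [∀ i, MeasurableSpace (E i)]
    {Ω : Type*} [MeasurableSpace Ω] (μ : Measure Ω) where
  f : ∀ i, (∀ j : G.parents i, S j) → E i → S i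
  measurable_f : ∀ i, Measurable fun q : (∀ j : G.parents i, S j) × E i => f i q.1 q.2
  U : ∀ i, Ω → E i
  measurable_U : ∀ i, Measurable (U i)
  indep_U : iIndepFun U μ

namespace NPSEMIE

variable {V : Type*} {G : DAG V} {S E : V → Type*}
  [∀ i, MeasurableSpace (S i)] [∀ i, MeasurableSpace (E i)]
  {Ω : Type*} [MeasurableSpace Ω] {μ : Measure Ω}

/-- The variable of node `i` in the model, defined by the recurrence
`V_i = f_i (PA_i, U_i)` along the DAG. -/
noncomputable def var [Finite V] (M : NPSEMIE G S E μ) (i : V) (ω : Ω) : S i :=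
  G.wf.fix (C := S) (fun i rec => M.f i (fun j => rec j j.2) (M.U i ω)) i

theorem var_eq [Finite V] (M : NPSEMIE G S E μ) (i : V) (ω : Ω) :
    M.var i ω = M.f i (fun j => M.var j ω) (M.U i ω) := by
  unfold var
  rw [WellFounded.fix_eq]

open Classical in
/-- The surgically modified model `M_a = (F_a, U)`: the function of each node `i` of `A` is
replaced by the constant `a_i`, all other functions and the disturbances are unchanged. -/
noncomputable def surgery (M : NPSEMIE G S E μ) (A : Set V) (a : ∀ i : A, S i) :
    NPSEMIE G S E μ where
  f i := if h : i ∈ A then fun _ _ => a ⟨i, h⟩ else M.f i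
  measurable_f i := by
    by_cases h : i ∈ A
    · simp only [h, dite_true]
      exact measurable_const
    · simpa only [h, dite_false] using M.measurable_f i
  U := M.U
  measurable_U := M.measurable_U
  indep_U := M.indep_U

/-- The event that the variables of the nodes in `B` take the values `b`. -/
def event [Finite V] (M : NPSEMIE G S E μ) (B : Set V) (b : ∀ i : B, S i) : Set Ω :=
  {ω | ∀ i : B, M.var i ω = b i}

end NPSEMIE

end Causal

/-!
The criterion reduces to the statement that, given `L = l`, the treatment event `A = a` is
independent of the counterfactual response `Y_a`
(`Causal.NPSEMIE.measure_counterfactual_inter_mul`). On `A = a` the factual and the counterfactual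
response agree, so this independence turns `P(Y = y | A = a, L = l)` into `P(Y_a = y | L = l)`, and
summing over `l` gives the formula.

The conditional independence is derived from the independence of the disturbances alone, without
conditional distributions. On the event `L = l` all variables may be replaced by those of the model
in which the nodes of `L` are set to `l`, and the event itself says that in this model the mechanism
of each node of `L` reproduces its prescribed value (`mem_event_iff`). As `L` contains no descendant
of `A`, the response `Y_a` may likewise be replaced by its value in the model in which both `A` and
`L` are set. Let `C` be the set of nodes whose disturbance is met by open walks that leave `A`
against an arrow (`reachedNoise`). Then the treatment in the model with `L` set depends only on the
disturbances of `C`; the mechanism of each node of `L` depends only on those of `C` or only on those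
outside `C`; and the response in the model with `A` and `L` set depends only on those outside `C`.
Hence the joint event factors over two independent σ-algebras, which gives the conditional
independence.

The last of these dependence statements is where the graph enters: it holds unless an open walk
leads from `A` against an arrow to the response. A shortest such walk repeats no node
(`IsOpenWalk.cut`), hence is a back-door path that `L` does not block
(`BlocksBackDoor.not_isOpenWalk`).
-/

namespace Causal

namespace DAG

variable {V : Type*} {G : DAG V} {A L : Set V}

theorem adj_asymm (G : DAG V) {i j : V} (h : G.Adj i j) : ¬ G.Adj j i := fun h' =>
  G.acyclic i ((Relation.TransGen.single h).tail h')

/-! ### Open walks and open paths -/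

/-- The vertices `w 0, …, w n` form a walk which starts with an arrow into `w 0 ∈ A`, never returns
to `A`, and is open given `L`: every inner collider lies in `L` or has a descendant in `L`, and no
inner non-collider lies in `L`. Values of `w` beyond `n` are irrelevant. -/
structure IsOpenWalk (G : DAG V) (A L : Set V) (w : ℕ → V) (n : ℕ) : Prop where
  pos : 1 ≤ n
  start : w 0 ∈ A
  notMem : ∀ k, 1 ≤ k → k ≤ n → w k ∉ A
  first : G.Adj (w 1) (w 0)
  adj : ∀ k, k + 1 ≤ n → G.Adj (w k) (w (k + 1)) ∨ G.Adj (w (k + 1)) (w k)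
  collider : ∀ k, k + 2 ≤ n → G.Adj (w k) (w (k + 1)) → G.Adj (w (k + 2)) (w (k + 1)) →
    ∃ l ∈ L, Relation.ReflTransGen G.Adj (w (k + 1)) l
  noncollider : ∀ k, k + 2 ≤ n →
    G.Adj (w (k + 1)) (w k) ∨ G.Adj (w (k + 1)) (w (k + 2)) → w (k + 1) ∉ L

namespace IsOpenWalk

theorem single {u x : V} (hu : u ∈ A) (hx : x ∉ A) (h : G.Adj x u) :
    G.IsOpenWalk A L (fun k => if k = 0 then u else x) 1 where
  pos := le_rfl
  start := by simpa
  notMem k h1 _ := by simpa [show k ≠ 0 by omega]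
  first := by simpa
  adj k hk := by
    obtain rfl : k = 0 := by omega
    simpa using Or.inr h
  collider k hk := by omega
  noncollider k hk := by omega

theorem snoc {w : ℕ → V} {n : ℕ} (hw : G.IsOpenWalk A L w (n + 1)) {x : V} (hx : x ∉ A)
    (hadj : G.Adj (w (n + 1)) x ∨ G.Adj x (w (n + 1)))
    (hc : G.Adj (w n) (w (n + 1)) → G.Adj x (w (n + 1)) →
      ∃ l ∈ L, Relation.ReflTransGen G.Adj (w (n + 1)) l)
    (hn : G.Adj (w (n + 1)) (w n) ∨ G.Adj (w (n + 1)) x → w (n + 1) ∉ L) :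
    G.IsOpenWalk A L (fun k => if k ≤ n + 1 then w k else x) (n + 2) where
  pos := by omega
  start := by simpa using hw.start
  notMem k h1 h2 := by
    by_cases hk : k ≤ n + 1
    · simpa [hk] using hw.notMem k h1 hk
    · simpa [hk] using hx
  first := by simpa using hw.first
  adj k hk := by
    rcases Nat.lt_or_ge k (n + 1) with h | h
    · simpa [show k ≤ n + 1 by omega, show k ≤ n by omega] using hw.adj k (by omega)
    · obtain rfl : k = n + 1 := by omega
      simpa using hadj
  collider k hk := by
    rcases Nat.lt_or_ge k n with h | h
    · simpa [show k ≤ n + 1 by omega, show k ≤ n by omega, show k + 1 ≤ n by omega] using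
        hw.collider k (by omega)
    · obtain rfl : k = n := by omega
      simpa using hc
  noncollider k hk := by
    rcases Nat.lt_or_ge k n with h | h
    · simpa [show k ≤ n + 1 by omega, show k ≤ n by omega, show k + 1 ≤ n by omega] using
        hw.noncollider k (by omega)
    · obtain rfl : k = n := by omega
      simpa using hn

/-- A stretch of an open walk whose two end edges both point inwards contains a collider, and the
first one is a descendant of the left end. -/
theorem exists_mem_of_adj {w : ℕ → V} {n : ℕ} (hw : G.IsOpenWalk A L w n) (d : ℕ) :
    ∀ i, i + d + 1 ≤ n → G.Adj (w i) (w (i + 1)) → G.Adj (w (i + d + 1)) (w (i + d)) →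
      ∃ l ∈ L, Relation.ReflTransGen G.Adj (w i) l := by
  induction d with
  | zero => exact fun i _ h h' => absurd h' (G.adj_asymm h)
  | succ d ih =>
    intro i hi h h'
    rcases hw.adj (i + 1) (by omega) with h2 | h2
    · obtain ⟨l, hl, hr⟩ := ih (i + 1) (by omega) h2
        (by simpa [show i + 1 + d = i + (d + 1) by omega] using h')
      exact ⟨l, hl, hr.head h⟩
    · obtain ⟨l, hl, hr⟩ := hw.collider i (by omega) h h2
      exact ⟨l, hl, hr.head h⟩

/-- Cutting a loop out of an open walk leaves an open walk. If the node at which the loop is cut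
becomes a collider without having been one, then the loop left it along an arrow and came back along
an arrow out of it, so that the loop contains a collider among its descendants. -/
theorem cut {w : ℕ → V} {n : ℕ} (hw : G.IsOpenWalk A L w n) {i d : ℕ} (hi : 1 ≤ i) (hd : 1 ≤ d)
    (hn : i + d ≤ n) (heq : w i = w (i + d)) :
    G.IsOpenWalk A L (fun k => if k ≤ i then w k else w (k + d)) (n - d) := by
  have hge : ∀ k, i ≤ k → (if k ≤ i then w k else w (k + d)) = w (k + d) := by
    intro k hk
    split_ifs with h
    · obtain rfl : k = i := by omega
      exact heq
    · rfl
  have hle : ∀ k, k ≤ i → (if k ≤ i then w k else w (k + d)) = w k := fun k hk => if_pos hk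
  refine ⟨by omega, ?_, fun k h1 h2 => ?_, ?_, fun k hk => ?_, fun k hk => ?_, fun k hk => ?_⟩
  · simpa using hw.start
  · rcases le_total k i with h | h
    · rw [hle k h]; exact hw.notMem k h1 (by omega)
    · rw [hge k h]; exact hw.notMem _ (by omega) (by omega)
  · rw [hle 1 hi, hle 0 (by omega)]; exact hw.first
  · rcases Nat.lt_or_ge k i with h | h
    · rw [hle k (by omega), hle (k + 1) (by omega)]; exact hw.adj k (by omega)
    · rw [hge k h, hge (k + 1) (by omega), show k + 1 + d = k + d + 1 by omega]
      exact hw.adj (k + d) (by omega)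
  · rcases Nat.lt_trichotomy (k + 1) i with h | h | h
    · rw [hle k (by omega), hle (k + 1) (by omega), hle (k + 2) (by omega)]
      exact hw.collider k (by omega)
    · rw [hle k (by omega), hle (k + 1) (by omega), hge (k + 2) (by omega)]
      intro h1 h2
      subst h
      rcases hw.adj (k + 1) (by omega) with h3 | h3
      · obtain ⟨d, rfl⟩ : ∃ e, d = e + 1 := ⟨d - 1, by omega⟩
        rcases hw.adj (k + d + 1) (by omega) with h4 | h4
        · have hc := hw.collider (k + d + 1) (by omega) h4
          rw [show k + d + 1 + 2 = k + 2 + (d + 1) by omega,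
            show k + d + 1 + 1 = k + 1 + (d + 1) by omega, ← heq] at hc
          exact hc h2
        · exact hw.exists_mem_of_adj d (k + 1) (by omega) h3
            (by simpa [show k + 1 + d = k + d + 1 by omega] using h4)
      · exact hw.collider k (by omega) h1 h3
    · rw [hge k (by omega), hge (k + 1) (by omega), hge (k + 2) (by omega),
        show k + 1 + d = k + d + 1 by omega, show k + 2 + d = k + d + 2 by omega]
      exact hw.collider (k + d) (by omega)
  · rcases Nat.lt_trichotomy (k + 1) i with h | h | h
    · rw [hle k (by omega), hle (k + 1) (by omega), hle (k + 2) (by omega)]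
      exact hw.noncollider k (by omega)
    · rw [hle k (by omega), hle (k + 1) (by omega), hge (k + 2) (by omega)]
      rintro (h1 | h1)
      · exact hw.noncollider k (by omega) (Or.inl h1)
      · subst h
        rw [heq] at h1 ⊢
        have := hw.noncollider (k + d) (by omega)
        rw [show k + d + 1 = k + 1 + d by omega, show k + d + 2 = k + 2 + d by omega] at this
        exact this (Or.inr h1)
    · rw [hge k (by omega), hge (k + 1) (by omega), hge (k + 2) (by omega),
        show k + 1 + d = k + d + 1 by omega, show k + 2 + d = k + d + 2 by omega]
      exact hw.noncollider (k + d) (by omega)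

end IsOpenWalk

theorem exists_walk_of_forall_adj {H : SimpleGraph V} (n : ℕ) :
    ∀ w : ℕ → V, (∀ k, k + 1 ≤ n → H.Adj (w k) (w (k + 1))) →
      ∃ p : H.Walk (w 0) (w n), p.length = n ∧ ∀ k ≤ n, p.getVert k = w k := by
  induction n with
  | zero =>
    intro w _
    refine ⟨.nil, rfl, fun k hk => ?_⟩
    obtain rfl : k = 0 := by omega
    rfl
  | succ n ih =>
    intro w hw
    obtain ⟨p, hp, hv⟩ := ih (fun k => w (k + 1)) fun k hk => hw (k + 1) (by omega)
    refine ⟨.cons (hw 0 (by omega)) p, by simp [hp], fun k hk => ?_⟩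
    cases k with
    | zero => rfl
    | succ k => exact hv k (by omega)

/-- If `L` blocks all back-door paths from `A` to `y`, no open walk ends in `y`: a shortest one
would repeat no node. -/
theorem BlocksBackDoor.not_isOpenWalk {y : V} (hb : G.BlocksBackDoor L A y) (n : ℕ) :
    ∀ w : ℕ → V, w n = y → ¬ G.IsOpenWalk A L w n := by
  induction n using Nat.strong_induction_on with
  | _ n ih =>
    intro w hy hw
    by_cases hloop : ∃ i d, 1 ≤ i ∧ 1 ≤ d ∧ i + d ≤ n ∧ w i = w (i + d)
    · obtain ⟨i, d, hi, hd, hn, heq⟩ := hloop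
      refine ih (n - d) (by omega) _ ?_ (hw.cut hi hd hn heq)
      rcases Nat.lt_or_ge i (n - d) with h | h
      · simpa [show ¬ n - d ≤ i by omega, show n - d + d = n by omega] using hy
      · obtain rfl : n = i + d := by omega
        simpa [heq] using hy
    · have hinj : ∀ i j, i < j → j ≤ n → w i ≠ w j := by
        intro i j hij hj heq
        rcases Nat.eq_zero_or_pos i with rfl | hi
        · exact hw.notMem j hij hj (heq ▸ hw.start)
        · exact hloop ⟨i, j - i, hi, by omega, by omega, by
            rwa [show i + (j - i) = j by omega]⟩
      subst hy
      obtain ⟨p, hp, hv⟩ := exists_walk_of_forall_adj (H := G.skeleton) n w hw.adj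
      have hpath : p.IsPath := by
        rw [← SimpleGraph.Walk.IsPath.getVert_injOn_iff]
        intro i hi j hj hij
        rw [Set.mem_ofPred_eq, hp] at hi hj
        rw [hv i hi, hv j hj] at hij
        by_contra hne
        rcases Nat.lt_or_gt_of_ne hne with h | h
        · exact hinj i j h hj hij
        · exact hinj j i h hi hij.symm
      obtain ⟨k, hk, hkb⟩ := hb (w 0) hw.start p
        ⟨hpath, hp.symm ▸ hw.pos, by rw [hv 1 hw.pos]; exact hw.first⟩
      rw [hp] at hk
      simp only [IsCollider, hv k (by omega), hv (k + 1) (by omega), hv (k + 2) (by omega)] at hkb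
      rcases hkb with ⟨hc, hL⟩ | ⟨⟨h1, h2⟩, hL, hD⟩
      · refine hw.noncollider k hk ?_ hL
        rcases hw.adj k (by omega), hw.adj (k + 1) (by omega) with ⟨h1 | h1, h2 | h2⟩
        · exact Or.inr h2
        · exact absurd ⟨h1, h2⟩ hc
        · exact Or.inl h1
        · exact Or.inl h1
      · obtain ⟨l, hl, hr⟩ := hw.collider k hk h1 h2
        rcases Relation.reflTransGen_iff_eq_or_transGen.mp hr with rfl | h
        · exact hL hl
        · exact hD l h hl

/-! ### Reachability from `A` along open walks -/

/-- How an open walk arrives at a node: `up` along an arrow out of that node (against the arrow),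
`down` along an arrow into it. -/
inductive Heading
  | up
  | down

/-- `G.Reach A L h v`: an open walk given `L` which leaves `A` against an arrow arrives at `v` with
heading `h`. Only colliders in `L` itself are passed; that is no restriction, since a walk may go
down from a collider to a descendant in `L` and back. The nodes of `A` count as reached upwards, and
a walk that meets a node of `A` leaves it against an arrow only, so that it may be taken to start
there. -/
inductive Reach (G : DAG V) (A L : Set V) : Heading → V → Prop
  | start {u : V} : u ∈ A → Reach G A L .up u
  | chain_up {v x : V} : Reach G A L .up v → v ∉ L → G.Adj x v → Reach G A L .up x
  | fork {v x : V} : Reach G A L .up v → v ∉ L → v ∉ A → G.Adj v x → Reach G A L .down x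
  | chain_down {v x : V} : Reach G A L .down v → v ∉ L → v ∉ A → G.Adj v x → Reach G A L .down x
  | collider {v x : V} : Reach G A L .down v → v ∈ L → G.Adj x v → Reach G A L .up x

/-- The arrow between the last two nodes `u, v` of a walk that arrives at `v` with a given
heading. -/
def Heading.Arrow (G : DAG V) : Heading → V → V → Prop
  | .up, u, v => G.Adj v u
  | .down, u, v => G.Adj u v

theorem Reach.exists_isOpenWalk (hd : Disjoint L A) {h : Heading} {v : V} (hr : G.Reach A L h v) :
    v ∉ A → ∃ w n, G.IsOpenWalk A L w (n + 1) ∧ w (n + 1) = v ∧ h.Arrow G (w n) v := by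
  have key : ∀ {w : ℕ → V} {n : ℕ} {x : V} {h : Heading},
      G.IsOpenWalk A L (fun k => if k ≤ n + 1 then w k else x) (n + 2) → h.Arrow G (w (n + 1)) x →
      ∃ w' n', G.IsOpenWalk A L w' (n' + 1) ∧ w' (n' + 1) = x ∧ h.Arrow G (w' n') x :=
    fun {w n x h} hw ha => ⟨_, n + 1, hw, by simp, by simpa using ha⟩
  induction hr with
  | start hu => exact fun h => absurd hu h
  | @chain_up v x _ hL hx ih =>
    intro hxA
    by_cases hv : v ∈ A
    -- A walk that meets `A` at `v` is dropped, and a new one starts there.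
    · exact ⟨_, 0, .single hv hxA hx, by simp, by simpa [Heading.Arrow] using hx⟩
    · obtain ⟨w, n, hw, rfl, ha⟩ := ih hv
      exact key (hw.snoc hxA (.inr hx) (fun h => absurd h (G.adj_asymm ha)) fun _ => hL) hx
  | @fork v x _ hL hv hx ih =>
    intro hxA
    obtain ⟨w, n, hw, rfl, ha⟩ := ih hv
    exact key (hw.snoc hxA (.inl hx) (fun h => absurd h (G.adj_asymm ha)) fun _ => hL) hx
  | @chain_down v x _ hL hv hx ih =>
    intro hxA
    obtain ⟨w, n, hw, rfl, ha⟩ := ih hv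
    exact key (hw.snoc hxA (.inl hx) (fun _ h => absurd h (G.adj_asymm hx)) fun _ => hL) hx
  | @collider v x _ hL hx ih =>
    intro hxA
    obtain ⟨w, n, hw, rfl, ha⟩ := ih (Set.disjoint_left.mp hd hL)
    refine key (hw.snoc hxA (.inr hx) (fun _ _ => ⟨_, hL, .refl⟩) ?_) hx
    rintro (h | h)
    · exact absurd h (G.adj_asymm ha)
    · exact absurd h (G.adj_asymm hx)

theorem BlocksBackDoor.not_reach {y : V} (hb : G.BlocksBackDoor L A y) (hd : Disjoint L A)
    (hy : y ∉ A) (h : Heading) : ¬ G.Reach A L h y := fun hr =>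
  let ⟨w, _, hw, hwy, _⟩ := hr.exists_isOpenWalk hd hy
  hb.not_isOpenWalk _ w hwy hw

end DAG

end Causal

namespace Causal

namespace NPSEMIE

/-! ### Consistency of the surgically modified models -/

section

variable {V : Type*} {G : DAG V} {S E : V → Type*}
  [∀ i, MeasurableSpace (S i)] [∀ i, MeasurableSpace (E i)]
  {Ω : Type*} [MeasurableSpace Ω] {μ : Measure Ω}

theorem surgery_f_of_mem (M : NPSEMIE G S E μ) {B : Set V} (b : ∀ i : B, S i) {i : V}
    (hi : i ∈ B) : (M.surgery B b).f i = fun _ _ => b ⟨i, hi⟩ := by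
  simp [surgery, hi]

theorem surgery_f_of_notMem (M : NPSEMIE G S E μ) {B : Set V} (b : ∀ i : B, S i) {i : V}
    (hi : i ∉ B) : (M.surgery B b).f i = M.f i := by
  simp [surgery, hi]

variable [Finite V]

theorem var_eq_of_solution (M : NPSEMIE G S E μ) {ω : Ω} {z : ∀ i, S i}
    (hz : ∀ i, z i = M.f i (fun j => z j) (M.U i ω)) (i : V) : M.var i ω = z i := by
  induction i using G.wf.induction with
  | _ i ih =>
    rw [M.var_eq, hz i]
    congr 1
    exact funext fun j => ih j j.2

theorem surgery_var_of_mem (M : NPSEMIE G S E μ) {B : Set V} (b : ∀ i : B, S i) {i : V}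
    (hi : i ∈ B) (ω : Ω) : (M.surgery B b).var i ω = b ⟨i, hi⟩ := by
  rw [var_eq, surgery_f_of_mem M b hi]

theorem surgery_var_of_notMem (M : NPSEMIE G S E μ) {B : Set V} (b : ∀ i : B, S i) {i : V}
    (hi : i ∉ B) (ω : Ω) :
    (M.surgery B b).var i ω = M.f i (fun j => (M.surgery B b).var j ω) (M.U i ω) := by
  rw [var_eq, surgery_f_of_notMem M b hi]
  rfl

/-- Setting variables to the values that they take anyway changes nothing. -/
theorem surgery_var_of_mem_event (M : NPSEMIE G S E μ) {B : Set V} {b : ∀ i : B, S i} {ω : Ω}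
    (hω : ω ∈ M.event B b) (i : V) : (M.surgery B b).var i ω = M.var i ω := by
  refine var_eq_of_solution _ (z := fun i => M.var i ω) (fun i => ?_) i
  by_cases hi : i ∈ B
  · rw [surgery_f_of_mem M b hi]
    exact hω ⟨i, hi⟩
  · rw [surgery_f_of_notMem M b hi]
    exact M.var_eq i ω

/-- The value that the original mechanism of the node `i` yields on the variables of the model in
which the nodes of `B` are set to `b`. For `i ∈ B` it need not be `b i`. -/
noncomputable def naturalValue (M : NPSEMIE G S E μ) (B : Set V) (b : ∀ i : B, S i) (i : V)
    (ω : Ω) : S i :=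
  M.f i (fun j => (M.surgery B b).var j ω) (M.U i ω)

/-- The event that the variables of `B` take the values `b`, as an intersection of events on
separate mechanisms: in the model where the nodes of `B` are set to `b`, each of their natural
values is the one that was set. These involve only directed paths without inner nodes in `B`. -/
theorem mem_event_iff (M : NPSEMIE G S E μ) {B : Set V} {b : ∀ i : B, S i} {ω : Ω} :
    ω ∈ M.event B b ↔ ∀ i : B, M.naturalValue B b i ω = b i := by
  constructor
  · intro hω i
    unfold naturalValue
    simp only [M.surgery_var_of_mem_event hω]
    rw [← M.var_eq]
    exact hω i
  · intro h i
    rw [M.var_eq_of_solution (z := fun i => (M.surgery B b).var i ω) fun j => ?_]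
    · exact M.surgery_var_of_mem b i.2 ω
    · by_cases hj : j ∈ B
      · rw [M.surgery_var_of_mem b hj]
        exact (h ⟨j, hj⟩).symm
      · exact M.surgery_var_of_notMem b hj ω

theorem surgery_var_of_not_isDescendant (M : NPSEMIE G S E μ) {B : Set V} (b : ∀ i : B, S i)
    (ω : Ω) (i : V) (hi : i ∉ B) (hd : ∀ k ∈ B, ¬ G.IsDescendant k i) :
    (M.surgery B b).var i ω = M.var i ω := by
  induction i using G.wf.induction with
  | _ i ih =>
    rw [M.surgery_var_of_notMem b hi, M.var_eq]
    congr 1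
    funext j
    exact ih j j.2 (fun hj => hd j hj (.single j.2)) fun k hk h => hd k hk (h.tail j.2)

end

/-! ### Dependence on disturbances -/

/-- The σ-algebra generated by the disturbances of the nodes in `C`. -/
abbrev noise {V Ω : Type*} {E : V → Type*} [∀ i, MeasurableSpace (E i)] (U : ∀ i, Ω → E i)
    (C : Set V) : MeasurableSpace Ω :=
  ⨆ i ∈ C, MeasurableSpace.comap (U i) inferInstance

theorem measurable_noise {V Ω : Type*} {E : V → Type*} [∀ i, MeasurableSpace (E i)]
    (U : ∀ i, Ω → E i) {C : Set V} {i : V} (hi : i ∈ C) : Measurable[noise U C] (U i) :=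
  measurable_iff_comap_le.mpr (le_iSup₂_of_le i hi le_rfl)

theorem measurable_mechanism {V Ω : Type*} {G : DAG V} {S E : V → Type*}
    [∀ i, MeasurableSpace (S i)] [∀ i, MeasurableSpace (E i)] {m : MeasurableSpace Ω} {i : V}
    {f : (∀ j : G.parents i, S j) → E i → S i}
    (hf : Measurable fun q : (∀ j : G.parents i, S j) × E i => f q.1 q.2)
    {X : ∀ j, Ω → S j} (hX : ∀ j, G.Adj j i → Measurable (X j)) {U : Ω → E i}
    (hU : Measurable U) : Measurable fun ω => f (fun j => X j ω) (U ω) :=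
  hf.comp (Measurable.prodMk (measurable_pi_lambda _ fun j : G.parents i => hX j j.2) hU)

variable {V : Type*} {G : DAG V} {S E : V → Type*}
  [∀ i, MeasurableSpace (S i)] [∀ i, MeasurableSpace (E i)]
  {Ω : Type*} [MeasurableSpace Ω] {μ : Measure Ω}

theorem noise_le (M : NPSEMIE G S E μ) (C : Set V) : noise M.U C ≤ ‹MeasurableSpace Ω› :=
  iSup₂_le fun i _ => (M.measurable_U i).comap_le

theorem indep_noise_compl (M : NPSEMIE G S E μ) (C : Set V) :
    Indep (noise M.U C) (noise M.U Cᶜ) μ :=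
  indep_iSup_of_disjoint (fun i => (M.measurable_U i).comap_le) M.indep_U.iIndep
    disjoint_compl_right

variable [Finite V]

/-- If `D` is closed under parents except at nodes with constant mechanism, and `C` contains the
remaining nodes of `D`, then the variables of `D` depend only on the disturbances of `C`. -/
theorem measurable_var_noise (M : NPSEMIE G S E μ) {C D : Set V}
    (h : ∀ i ∈ D, (∃ c, M.f i = fun _ _ => c) ∨ (i ∈ C ∧ ∀ j, G.Adj j i → j ∈ D))
    (i : V) (hi : i ∈ D) : Measurable[noise M.U C] (M.var i) := by
  induction i using G.wf.induction with
  | _ i ih =>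
    rw [funext (M.var_eq i)]
    rcases h i hi with ⟨c, hc⟩ | ⟨hiC, hp⟩
    · rw [hc]
      exact measurable_const
    · exact measurable_mechanism (M.measurable_f i) (fun j hj => ih j hj (hp j hj))
        (measurable_noise M.U hiC)

theorem measurable_var (M : NPSEMIE G S E μ) (i : V) : Measurable (M.var i) :=
  (M.measurable_var_noise (C := Set.univ) (D := Set.univ) (fun _ _ => .inr (by simp)) i
    trivial).mono (M.noise_le _) le_rfl

theorem measurableSet_event [∀ i, MeasurableSingletonClass (S i)] (M : NPSEMIE G S E μ)
    (B : Set V) (b : ∀ i : B, S i) : MeasurableSet (M.event B b) := by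
  simp only [event, Set.ofPred_forall]
  exact .iInter fun i => M.measurable_var i (measurableSet_singleton _)

end NPSEMIE

/-! ### Conditional independence of treatment and counterfactual response -/

/-- If `F, P` are independent of `H, Q`, then `F` and `H` are independent given `P ∩ Q`. -/
theorem measure_inter_mul_of_indep {Ω : Type*} [MeasurableSpace Ω] {μ : Measure Ω}
    {m₁ m₂ : MeasurableSpace Ω} (hi : Indep m₁ m₂ μ) {F P H Q : Set Ω}
    (hF : MeasurableSet[m₁] F) (hP : MeasurableSet[m₁] P) (hH : MeasurableSet[m₂] H)
    (hQ : MeasurableSet[m₂] Q) :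
    μ ((F ∩ P) ∩ (H ∩ Q)) * μ (P ∩ Q) = μ (P ∩ (H ∩ Q)) * μ ((F ∩ P) ∩ Q) := by
  rw [Indep_iff] at hi
  rw [hi _ _ (hF.inter hP) (hH.inter hQ), hi _ _ hP hQ, hi _ _ hP (hH.inter hQ),
    hi _ _ (hF.inter hP) hQ]
  ring

/-- The disturbances on which the treatment depends given `L`: those of the nodes outside `L` which
an open walk from `A` reaches against an arrow, and those of the nodes of `L` which it reaches along
an arrow. -/
def DAG.reachedNoise {V : Type*} (G : DAG V) (A L : Set V) : Set V :=
  {j | (j ∉ L ∧ G.Reach A L .up j) ∨ (j ∈ L ∧ G.Reach A L .down j)}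

namespace NPSEMIE

variable {V : Type*} [Finite V] {G : DAG V} {S E : V → Type*}
  [∀ i, MeasurableSpace (S i)] [∀ i, MeasurableSpace (E i)]
  {Ω : Type*} [MeasurableSpace Ω] {μ : Measure Ω} {A L : Set V}

theorem measurable_surgery_of_reach_up (M : NPSEMIE G S E μ) (l : ∀ i : L, S i) {i : V}
    (hi : i ∈ L ∨ G.Reach A L .up i) :
    Measurable[noise M.U (G.reachedNoise A L)] ((M.surgery L l).var i) := by
  refine measurable_var_noise (M.surgery L l) (D := {i | i ∈ L ∨ G.Reach A L .up i})
    (fun i hi => ?_) i hi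
  by_cases hL : i ∈ L
  · exact .inl ⟨_, M.surgery_f_of_mem l hL⟩
  · have hr : G.Reach A L .up i := hi.resolve_left hL
    exact .inr ⟨.inl ⟨hL, hr⟩, fun j hj => .inr (hr.chain_up hL hj)⟩

theorem measurable_naturalValue_of_mem (M : NPSEMIE G S E μ) (l : ∀ i : L, S i) {i : V}
    (hL : i ∈ L) (hi : i ∈ G.reachedNoise A L) :
    Measurable[noise M.U (G.reachedNoise A L)] (M.naturalValue L l i) := by
  have hr : G.Reach A L .down i := (hi.resolve_left fun h => h.1 hL).2
  exact measurable_mechanism (M.measurable_f i)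
    (fun j hj => M.measurable_surgery_of_reach_up l (.inr (hr.collider hL hj)))
    (measurable_noise M.U hi)

/-- A node of `L` which is not reached along an arrow has only parents that are not reached at all;
otherwise the open walk could be prolonged to it. That `A` has no descendant in `L` enters here: an
open walk cannot be prolonged along an arrow out of `A`. -/
theorem measurable_naturalValue_of_notMem (M : NPSEMIE G S E μ) (l : ∀ i : L, S i)
    (hdesc : ∀ i ∈ A, ∀ l ∈ L, ¬ G.IsDescendant i l) {i : V}
    (hL : i ∈ L) (hi : i ∉ G.reachedNoise A L) :
    Measurable[noise M.U (G.reachedNoise A L)ᶜ] (M.naturalValue L l i) := by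
  have hr : ¬ G.Reach A L .down i := fun h => hi (.inr ⟨hL, h⟩)
  have hparent : ∀ {i j : V}, (i ∈ L ∨ ∃ k ∈ L, G.IsDescendant i k) → ¬ G.Reach A L .down i →
      G.Adj j i →
      j ∈ L ∨ ((∃ k ∈ L, G.IsDescendant j k) ∧ ∀ h, ¬ G.Reach A L h j) := by
    intro i j hi hr hj
    by_cases hjL : j ∈ L
    · exact .inl hjL
    have hjd : ∃ k ∈ L, G.IsDescendant j k := by
      rcases hi with hi | ⟨k, hk, hd⟩
      · exact ⟨i, hi, .single hj⟩
      · exact ⟨k, hk, hd.head hj⟩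
    have hjA : j ∉ A := fun hA => let ⟨k, hk, hd⟩ := hjd; hdesc j hA k hk hd
    refine .inr ⟨hjd, fun h hjr => hr ?_⟩
    cases h with
    | up => exact hjr.fork hjL hjA hj
    | down => exact hjr.chain_down hjL hjA hj
  refine measurable_mechanism (M.measurable_f i) (fun j hj => ?_)
    (measurable_noise M.U (Set.mem_compl hi))
  refine measurable_var_noise (M.surgery L l)
    (D := {j | j ∈ L ∨ ((∃ k ∈ L, G.IsDescendant j k) ∧ ∀ h, ¬ G.Reach A L h j)})
    (fun j hj => ?_) j (hparent (.inl hL) hr hj)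
  by_cases hjL : j ∈ L
  · exact .inl ⟨_, M.surgery_f_of_mem l hjL⟩
  · obtain ⟨hd, hn⟩ := hj.resolve_left hjL
    refine .inr ⟨?_, fun k hk => hparent (.inr hd) (hn .down) hk⟩
    rintro (h | h)
    · exact hn _ h.2
    · exact hjL h.1

/-- The response in the model with both `A` and `L` set does not share any disturbance with the
treatment, because no open walk reaches it. -/
theorem measurable_surgery_surgery (M : NPSEMIE G S E μ) (a : ∀ i : A, S i) (l : ∀ i : L, S i)
    {i : V} (hi : i ∉ A → ∀ h, ¬ G.Reach A L h i) :
    Measurable[noise M.U (G.reachedNoise A L)ᶜ] (((M.surgery A a).surgery L l).var i) := by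
  refine measurable_var_noise ((M.surgery A a).surgery L l)
    (D := {i | i ∈ L ∨ (i ∉ A → ∀ h, ¬ G.Reach A L h i)}) (fun i hi => ?_) i (.inr hi)
  by_cases hL : i ∈ L
  · exact .inl ⟨_, surgery_f_of_mem _ l hL⟩
  by_cases hA : i ∈ A
  · exact .inl ⟨_, (surgery_f_of_notMem _ l hL).trans (M.surgery_f_of_mem a hA)⟩
  have hn := hi.resolve_left hL hA
  refine .inr ⟨?_, fun j hj => ?_⟩
  · rintro (h | h)
    · exact hn _ h.2
    · exact hL h.1
  · by_cases hjL : j ∈ L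
    · exact .inl hjL
    refine .inr fun hjA h hr => hn .down ?_
    cases h with
    | up => exact hr.fork hjL hjA hj
    | down => exact hr.chain_down hjL hjA hj

/-- Given `L = l`, the treatment is independent of the counterfactual response. -/
theorem measure_counterfactual_inter_mul [∀ i, MeasurableSingletonClass (S i)]
    (M : NPSEMIE G S E μ) {Y : V} (a : ∀ i : A, S i) (l : ∀ i : L, S i) (hdisj : Disjoint L A)
    (hdesc : ∀ i ∈ A, ∀ l ∈ L, ¬ G.IsDescendant i l) (hblock : G.BlocksBackDoor L A Y) (y : S Y) :
    μ ({ω | (M.surgery A a).var Y ω = y} ∩ (M.event A a ∩ M.event L l)) * μ (M.event L l) =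
      μ ({ω | (M.surgery A a).var Y ω = y} ∩ M.event L l) * μ (M.event A a ∩ M.event L l) := by
  set C := G.reachedNoise A L with hC
  set F : Set Ω := {ω | ∀ i : A, (M.surgery L l).var i ω = a i} with hF
  set P : Set Ω := {ω | ∀ i : L, (i : V) ∈ C → M.naturalValue L l i ω = l i} with hP
  set H : Set Ω := {ω | ((M.surgery A a).surgery L l).var Y ω = y} with hH
  set Q : Set Ω := {ω | ∀ i : L, (i : V) ∉ C → M.naturalValue L l i ω = l i} with hQ
  have hLPQ : M.event L l = P ∩ Q := by
    ext ω
    rw [M.mem_event_iff]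
    exact ⟨fun h => ⟨fun i _ => h i, fun i _ => h i⟩, fun h i =>
      (em ((i : V) ∈ C)).elim (h.1 i) (h.2 i)⟩
  have hAF : M.event A a ∩ M.event L l = (F ∩ P) ∩ Q := by
    rw [Set.inter_assoc, ← hLPQ]
    ext ω
    refine and_congr_left fun hω => forall_congr' fun i => ?_
    rw [M.surgery_var_of_mem_event hω]
  have hYH : {ω | (M.surgery A a).var Y ω = y} ∩ M.event L l = P ∩ (H ∩ Q) := by
    rw [Set.inter_left_comm, ← hLPQ]
    ext ω
    refine and_congr_left fun hω => ?_
    have hω' : ω ∈ (M.surgery A a).event L l := fun i => by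
      rw [M.surgery_var_of_not_isDescendant a ω i (Set.disjoint_left.mp hdisj i.2)
        fun k hk => hdesc k hk i i.2]
      exact hω i
    simp only [hH, Set.mem_ofPred_eq, surgery_var_of_mem_event _ hω']
  have hAll : {ω | (M.surgery A a).var Y ω = y} ∩ (M.event A a ∩ M.event L l) =
      (F ∩ P) ∩ (H ∩ Q) := by
    have h1 : {ω | (M.surgery A a).var Y ω = y} ∩ (M.event A a ∩ M.event L l) =
        ({ω | (M.surgery A a).var Y ω = y} ∩ M.event L l) ∩ (M.event A a ∩ M.event L l) := by
      ext ω; simp only [Set.mem_inter_iff]; tauto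
    rw [h1, hYH, hAF]
    ext ω; simp only [Set.mem_inter_iff]; tauto
  rw [hAll, hYH, hAF, hLPQ]
  refine measure_inter_mul_of_indep (M.indep_noise_compl C) ?_ ?_ ?_ ?_
  · simp only [hF, Set.ofPred_forall]
    exact .iInter fun i =>
      M.measurable_surgery_of_reach_up l (.inr (.start i.2)) (measurableSet_singleton _)
  · simp only [hP, Set.ofPred_forall]
    exact .iInter fun i => .iInter fun hi =>
      M.measurable_naturalValue_of_mem l i.2 hi (measurableSet_singleton _)
  · exact M.measurable_surgery_surgery a l (fun hA => hblock.not_reach hdisj hA)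
      (measurableSet_singleton _)
  · simp only [hQ, Set.ofPred_forall]
    exact .iInter fun i => .iInter fun hi =>
      M.measurable_naturalValue_of_notMem l hdesc i.2 hi (measurableSet_singleton _)

end NPSEMIE

end Causal

/-! ### The adjustment formula -/

theorem mainTheorem1 {V : Type*} [Finite V] (G : Causal.DAG V) {S E : V → Type*}
    [∀ i, MeasurableSpace (S i)] [∀ i, MeasurableSingletonClass (S i)]
    [∀ i, MeasurableSpace (E i)]
    {Ω : Type*} [MeasurableSpace Ω] (μ : Measure Ω) [IsProbabilityMeasure μ]
    (M : Causal.NPSEMIE G S E μ)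
    (A L : Set V) (Y : V)
    (hcount : ∀ i ∈ L, Countable (S i))
    (a : ∀ i : A, S i)
    (hdisj : Disjoint L A)
    (hdesc : ∀ i ∈ A, ∀ l ∈ L, ¬ G.IsDescendant i l)
    (hblock : G.BlocksBackDoor L A Y)
    (hpos : ∀ l : (∀ i : L, S i), 0 < μ (M.event L l) →
      0 < μ[M.event A a | M.event L l])
    (y : S Y) :
    μ {ω | (M.surgery A a).var Y ω = y} =
      ∑' l : (∀ i : L, S i),
        μ[{ω | M.var Y ω = y} | M.event A a ∩ M.event L l] * μ (M.event L l) := by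
  have : ∀ i : L, Countable (S i) := fun i => hcount i i.2
  have hA := M.measurableSet_event A a
  have hL := M.measurableSet_event L
  have hYa : MeasurableSet {ω | (M.surgery A a).var Y ω = y} :=
    (M.surgery A a).measurable_var Y (measurableSet_singleton y)
  have hunion : {ω | (M.surgery A a).var Y ω = y} =
      ⋃ l, {ω | (M.surgery A a).var Y ω = y} ∩ M.event L l := by
    rw [← Set.inter_iUnion, eq_comm, Set.inter_eq_left]
    exact fun ω _ => Set.mem_iUnion.mpr ⟨fun i => M.var i ω, fun _ => rfl⟩
  have hdisjoint : Pairwise fun l l' => Disjoint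
      ({ω | (M.surgery A a).var Y ω = y} ∩ M.event L l)
      ({ω | (M.surgery A a).var Y ω = y} ∩ M.event L l') := fun l l' hne =>
    Set.disjoint_left.mpr fun ω h h' => hne (funext fun i => (h.2 i).symm.trans (h'.2 i))
  rw [hunion, measure_iUnion hdisjoint fun l => hYa.inter (hL l)]
  refine tsum_congr fun l => ?_
  rcases eq_or_ne (μ (M.event L l)) 0 with h0 | h0
  · rw [h0, mul_zero]
    exact measure_mono_null Set.inter_subset_right h0
  have hAL : μ (M.event A a ∩ M.event L l) ≠ 0 := by
    rw [Set.inter_comm]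
    exact (inter_pos_of_cond_ne_zero (hL l) (hpos l (pos_iff_ne_zero.mpr h0)).ne').ne'
  -- On `A = a` the factual and the counterfactual response agree.
  have hcons : M.event A a ∩ M.event L l ∩ {ω | M.var Y ω = y} =
      {ω | (M.surgery A a).var Y ω = y} ∩ (M.event A a ∩ M.event L l) := by
    rw [Set.inter_comm]
    ext ω
    refine and_congr_left fun hω => ?_
    simp only [Set.mem_ofPred_eq, M.surgery_var_of_mem_event hω.1]
  rw [cond_apply (hA.inter (hL l)), hcons, mul_assoc,
    M.measure_counterfactual_inter_mul a l hdisj hdesc hblock y, mul_left_comm,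
    ENNReal.inv_mul_cancel hAL (measure_ne_top _ _), mul_one]
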